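/- **Setting.** Let $\mathcal X\subset\mathbb R^n$ be non-empty, convex and compact, let $f_1,\dots,f_N:\mathcal X\to\mathbb R$ be convex, $f=\sum_{i=1}^N f_i$, and let $x^*\in\arg\min_{x\in\mathcal X}f(x)$. Write $\partial f_i(a)=\{g\in\mathbb R^n: f_i(b)\ge f_i(a)+\langle g,b-a\rangle\ \forall b\in\mathcal X\}$, and $\|\cdot\|$ for the Euclidean norm. *Network.* For $t=0,1,2,\dots$ let $P(t)\in\mathbb R^{N\times N}$ be doubly stochastic (with non-negative entries). The pair $(j,i)$ is an edge at time $t$ iff $[P(t)]_{ij}\neq0$. There is $\theta\in(0,1)$ with $[P(t)]_{ij}\ge\theta$ on every edge and $[P(t)]_{ii}\ge\theta$ for all $i$, and there is an integer $B\ge1$ such that for every $c\ge0$ the union of the edge sets at the times $cB+1,\dots,(c+1)B$ is a strongly connected directed graph on $\{1,\dots,N\}$. *Distance generating function.* Let $\phi:\mathbb R^n\to\mathbb R$ be continuously differentiable and $\sigma_\phi$-strongly convex, $\sigma_\phi>0$, with Lipschitz gradient, and let $V_\phi(a,b)=\phi(a)-\phi(b)-\langle\nabla\phi(b),a-b\rangle$.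 Assume that $V_\phi$ is bounded above on $\mathcal X\times\mathcal X$ and that $V_\phi(a,\sum_{j=1}^N w_jb_j)\le\sum_{j=1}^N w_jV_\phi(a,b_j)$ for all $a,b_1,\dots,b_N\in\mathbb R^n$ and all $w_j\ge0$ with $\sum_j w_j=1$. *Subgradient bound.* $G$ is a constant such that every $f_i$ has at every point of $\mathcal X$ a subgradient of norm at most $G$, and such that all the subgradients used by the algorithm have norm at most $G$. *Quantizer.* Let $K\ge1$ be an integer. For $z,d,x\in\mathbb R$ put $Q(z,d,x)=z-d$ if $x-z<-d$, $Q(z,d,x)=z+d$ if $x-z\ge d$, and $Q(z,d,x)=z+\frac{(2j-K)d}{K}$ if $x-z+d\in[\frac{2jd}{K},\frac{2(j+1)d}{K})$, $j\in\{0,\dots,K-1\}$. On $\mathbb R^n$ let $\widehat Q(z,d,x)$ be $Q$ applied in each coordinate. *Parameters.* $\alpha(t),\beta(t)\in(0,1)$, $t=0,1,2,\dots$, are non-increasing, and $\tau\ge0$ is an integer (the delay). *Algorithm 1.* Start from $x_i(0)\in\mathcal X$, $z_i(0)=x_i(0)$ and $\tilde y_i(-\tau),\dots,\tilde y_i(-1)\in\mathcal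 X$. For $t=0,1,2,\dots$ and every $i$, with $d(t)=\frac{G\alpha(t)\beta(t)}{\sigma_\phi}\mathbf 1$, $$y_i(t)=\sum_{j=1}^N[P(t)]_{ij}\,\widehat Q(z_j(t),d(t),x_j(t)),\qquad \tilde y_i(t)=\arg\min_{b\in\mathcal X}\|b-y_i(t)\|,\qquad g_i(t-\tau)\in\partial f_i(\tilde y_i(t-\tau)),$$ $$z_i(t+1)=\arg\min_{x\in\mathcal X}\Big\{\langle g_i(t-\tau),x\rangle+\frac{V_\phi(x,\tilde y_i(t))}{\alpha(t+1)(1-\beta(t+1))}\Big\},\qquad x_i(t+1)=\arg\min_{x\in\mathcal X}\Big\{\langle g_i(t-\tau),x\rangle+\frac{V_\phi(x,\tilde y_i(t))}{\alpha(t+1)}\Big\}.$$ Let $\hat x_l(T)=\frac1T\sum_{t=1}^Tx_l(t)$. **Theorem.** If $$\lim_{T\to\infty}\frac1{T\alpha(T+\tau)}=0,\qquad \lim_{T\to\infty}\frac1T\sum_{t=1}^{T+\tau}\alpha(t)=0,\qquad \lim_{T\to\infty}\frac1T\sum_{t=1}^{T+\tau}\beta(t)=0,$$ then $\lim_{T\to\infty}f(\hat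 x_l(T))=f(x^*)$ for every agent $l\in\{1,\dots,N\}$. -/

import Mathlib

open Filter Topology

noncomputable section

/-- `ℝⁿ` with the Euclidean norm. -/
abbrev Vec (n : ℕ) : Type := EuclideanSpace ℝ (Fin n)

/-- The subdifferential at `a` of a function `h` with domain `X`: the vectors `g` such that
`h b ≥ h a + ⟨g, b - a⟩` for every `b` in the domain. -/
def subdifferential {n : ℕ} (X : Set (Vec n)) (h : Vec n → ℝ) (a : Vec n) : Set (Vec n) :=
  {g | ∀ b ∈ X, h a + inner ℝ g (b - a) ≤ h b}

/-- `p` minimizes `F` over `X`, that is, `p ∈ argmin_{x ∈ X} F x`. -/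
def IsArgmin {n : ℕ} (X : Set (Vec n)) (F : Vec n → ℝ) (p : Vec n) : Prop :=
  p ∈ X ∧ IsMinOn F X p

/-- `φ` is strongly convex with modulus `σ` (first-order form, for differentiable `φ`). -/
def IsStronglyConvex {n : ℕ} (φ : Vec n → ℝ) (σ : ℝ) : Prop :=
  ∀ a b : Vec n, φ a + inner ℝ (gradient φ a) (b - a) + σ / 2 * ‖b - a‖ ^ 2 ≤ φ b

/-- The Bregman divergence `V_φ(a, b) = φ a - φ b - ⟨∇φ b, a - b⟩`. -/
def bregman {n : ℕ} (φ : Vec n → ℝ) (a b : Vec n) : ℝ :=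
  φ a - φ b - inner ℝ (gradient φ b) (a - b)

/-- Separate convexity of the Bregman divergence, for convex combinations of `N` points. -/
def SeparatelyConvex {n : ℕ} (N : ℕ) (φ : Vec n → ℝ) : Prop :=
  ∀ (a : Vec n) (b : Fin N → Vec n) (w : Fin N → ℝ), (∀ j, 0 ≤ w j) → ∑ j, w j = 1 →
    bregman φ a (∑ j, w j • b j) ≤ ∑ j, w j * bregman φ a (b j)

/-- The uniform quantizer on `ℝ` with the `K + 1` levels `z + (2 j - K) d / K`, `0 ≤ j ≤ K`.
Inside `[z - d, z + d)` the index `j` is the one with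
`x - z + d ∈ [2 j d / K, 2 (j + 1) d / K)`, which is the floor of `(x - z + d) K / (2 d)`. -/
def uniformQuantizer (K : ℕ) (z d x : ℝ) : ℝ :=
  if x - z < -d then z - d
  else if d ≤ x - z then z + d
  else z + (2 * (⌊(x - z + d) * K / (2 * d)⌋ : ℝ) - K) * d / K

/-- The floor in `uniformQuantizer` picks the cell that contains `x`. -/
theorem uniformQuantizer_eq_of_mem_cell {K : ℕ} (hK : 1 ≤ K) {z d x : ℝ} (hd : 0 < d)
    {j : ℕ} (hj : j < K)
    (h : x - z + d ∈ Set.Ico (2 * (j : ℝ) * d / K) (2 * ((j : ℝ) + 1) * d / K)) :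
    uniformQuantizer K z d x = z + (2 * (j : ℝ) - K) * d / K := by
  have hK0 : (0 : ℝ) < K := by exact_mod_cast hK
  obtain ⟨h1, h2⟩ := h
  rw [div_le_iff₀ hK0] at h1
  rw [lt_div_iff₀ hK0] at h2
  have hjK : (j : ℝ) + 1 ≤ K := by exact_mod_cast hj
  have hj0 : (0 : ℝ) ≤ j := Nat.cast_nonneg j
  have hlow : ¬ (x - z < -d) := by
    intro hlt
    have : (x - z + d) * K < 0 := mul_neg_of_neg_of_pos (by linarith) hK0
    have : 0 ≤ 2 * (j : ℝ) * d := by positivity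
    linarith
  have hup : ¬ (d ≤ x - z) := by
    intro hle
    have e1 : 2 * d * K ≤ (x - z + d) * K := mul_le_mul_of_nonneg_right (by linarith) hK0.le
    have e2 : 2 * ((j : ℝ) + 1) * d ≤ 2 * K * d :=
      mul_le_mul_of_nonneg_right (by linarith) hd.le
    linarith
  have hfl : ⌊(x - z + d) * K / (2 * d)⌋ = (j : ℤ) := by
    rw [Int.floor_eq_iff]
    constructor
    · rw [le_div_iff₀ (by positivity)]; push_cast; linarith
    · rw [div_lt_iff₀ (by positivity)]; push_cast; linarith
  simp only [uniformQuantizer, if_neg hlow, if_neg hup, hfl]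
  push_cast
  rfl

/-- The uniform quantizer on `ℝⁿ`, applied coordinate by coordinate. -/
def vecQuantizer {n : ℕ} (K : ℕ) (z d x : Vec n) : Vec n :=
  WithLp.toLp 2 fun k => uniformQuantizer K (z k) (d k) (x k)

/-- Agent `j` sends to agent `i` at time `t`: the pair is an edge of the communication graph
exactly when the weight `[P(t)]_{ij}` does not vanish. -/
def Connected {N : ℕ} (P : ℕ → Matrix (Fin N) (Fin N) ℝ) (t : ℕ) (j i : Fin N) : Prop :=
  P t i j ≠ 0

/-- For every `c ≥ 0` the directed graph whose edges are those present at some time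
`t ∈ {cB + 1, …, (c + 1)B}` is strongly connected. -/
def JointlyStronglyConnected {N : ℕ} (P : ℕ → Matrix (Fin N) (Fin N) ℝ) (B : ℕ) : Prop :=
  ∀ (c : ℕ) (u v : Fin N), Relation.ReflTransGen
    (fun j i => ∃ t ∈ Finset.Icc (c * B + 1) ((c + 1) * B), Connected P t j i) u v

/-- The vector `d(t) = (G α(t) β(t) / σ) 𝟏` of quantization interval sizes. -/
def intervalSize (n : ℕ) (G σ : ℝ) (α β : ℕ → ℝ) (t : ℕ) : Vec n :=
  WithLp.toLp 2 fun _ => G * α t * β t / σ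

/-- The sequences `x`, `z`, `y`, `ytil`, `g` are produced by the distributed mirror descent
algorithm with delay `τ` and adaptive quantization. Here `x`, `z`, `y` are indexed by the times
`t = 0, 1, 2, …`, while the projected points `ytil` and the subgradients `g` carry integer times,
because they are used from time `-τ` on; nothing is said about them before `-τ`. -/
structure IsAlgorithmRun {N n : ℕ} (X : Set (Vec n)) (f : Fin N → Vec n → ℝ)
    (φ : Vec n → ℝ) (σ G : ℝ) (K τ : ℕ) (P : ℕ → Matrix (Fin N) (Fin N) ℝ) (α β : ℕ → ℝ)
    (x z y : Fin N → ℕ → Vec n) (ytil g : Fin N → ℤ → Vec n) : Prop where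
  init_x : ∀ i, x i 0 ∈ X
  init_z : ∀ i, z i 0 = x i 0
  init_ytil : ∀ i, ∀ s : ℤ, -(τ : ℤ) ≤ s → s ≤ -1 → ytil i s ∈ X
  step_y : ∀ i, ∀ t : ℕ,
    y i t = ∑ j, P t i j • vecQuantizer K (z j t) (intervalSize n G σ α β t) (x j t)
  step_ytil : ∀ i, ∀ t : ℕ, IsArgmin X (fun b => ‖b - y i t‖) (ytil i t)
  step_g : ∀ i, ∀ t : ℕ,
    g i ((t : ℤ) - τ) ∈ subdifferential X (f i) (ytil i ((t : ℤ) - τ))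
  step_z : ∀ i, ∀ t : ℕ, IsArgmin X
    (fun v => inner ℝ (g i ((t : ℤ) - τ)) v
      + bregman φ v (ytil i t) / (α (t + 1) * (1 - β (t + 1)))) (z i (t + 1))
  step_x : ∀ i, ∀ t : ℕ, IsArgmin X
    (fun v => inner ℝ (g i ((t : ℤ) - τ)) v
      + bregman φ v (ytil i t) / α (t + 1)) (x i (t + 1))

/-- The running average `(1/T) ∑_{t=1}^T u t`. -/
def runningAverage {n : ℕ} (u : ℕ → Vec n) (T : ℕ) : Vec n :=
  (1 / (T : ℝ)) • ∑ t ∈ Finset.Icc 1 T, u t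

end

/-!
# Convergence of quantized distributed mirror descent with delayed subgradients

The parameters `α` and `β` are non-increasing with vanishing averages, so they tend to zero
(`tendsto_zero_of_antitone_of_average`). The two mirror descent steps `x` and `z` differ by at most
`G α β / σ` (`IsAlgorithmRun.norm_x_sub_z_le`), and the quantizer returns a point at most one
interval size away from `z` in each coordinate, so that the projected point `ỹ i t` is within
`O(α t * β t)` of the exact average `∑ j, P t i j • x j t`. Together with the step itself, which
has length `O(α (t + 1))`, the states follow an averaging recursion with vanishing perturbations.
Joint strong connectivity makes products of `(N + 1) B` consecutive weight matrices uniformly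
positive (`pow_le_transition`), hence contractions for the disagreement, and the agents reach
consensus (`tendsto_norm_sub_of_averaging`). As a consequence, states and projected points of all
agents at times a bounded distance apart merge, which disposes of the delay
(`IsAlgorithmRun.tendsto_norm_ytil_sub_x`).

Let `S t = ∑ i, V_φ(x*, x i t)`. The mirror descent inequality, separate convexity of `V_φ` and
double stochasticity bound `S (t + 1) - S t` by `α (t + 1)` times a sum of inner products with
subgradients, plus `O(α t * β t)` (`IsAlgorithmRun.sum_bregman_succ_le`). The inner products
dominate minus the suboptimality of `x l (t - τ + 1)` up to vanishing distances
(`IsAlgorithmRun.sum_inner_le`). After division by `α (t + 1)` the suboptimality is at most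
`(S t - S (t + 1)) / α (t + 1)` plus a vanishing term plus `O(α t * β t / α (t + 1))`. The ratio
`α t / α (t + 1)` is not assumed bounded; the quotient `α t * β t / α (t + 1)` is, however, at most
`β t + (1 / α (t + 1) - 1 / α t)`, and the second part telescopes. Summation by parts
(`sum_le_of_telescoping`) leaves `O(1 / α (T + τ))` and a sum of vanishing terms. Division by `T`
and Jensen's inequality finish the proof.
-/


/-! ### Bregman divergences and mirror descent steps -/

section Bregman

variable {n : ℕ} {φ : Vec n → ℝ} {σ L : ℝ}

theorem IsStronglyConvex.monotone_gradient (hφ : IsStronglyConvex φ σ) (a b : Vec n) :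
    σ * ‖a - b‖ ^ 2 ≤ inner ℝ (gradient φ a - gradient φ b) (a - b) := by
  have h1 := hφ a b
  have h2 := hφ b a
  have h3 : inner ℝ (gradient φ a) (b - a) = - inner ℝ (gradient φ a) (a - b) := by
    rw [← inner_neg_right, neg_sub]
  rw [norm_sub_rev b a, h3] at h1
  rw [inner_sub_left]
  linarith

theorem IsStronglyConvex.bregman_nonneg (hφ : IsStronglyConvex φ σ) (hσ : 0 < σ) (a b : Vec n) :
    0 ≤ bregman φ a b := by
  have h1 := hφ b a
  have : 0 ≤ σ / 2 * ‖a - b‖ ^ 2 := by positivity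
  unfold bregman
  linarith

theorem bregman_le_of_lipschitz (hφ : IsStronglyConvex φ σ) (hσ : 0 < σ)
    (hL : ∀ a b : Vec n, ‖gradient φ a - gradient φ b‖ ≤ L * ‖a - b‖) (a b : Vec n) :
    bregman φ a b ≤ L * ‖a - b‖ ^ 2 := by
  have h1 := hφ a b
  have h0 : 0 ≤ σ / 2 * ‖b - a‖ ^ 2 := by positivity
  have h3 : inner ℝ (gradient φ a) (b - a) = - inner ℝ (gradient φ a) (a - b) := by
    rw [← inner_neg_right, neg_sub]
  have h4 : inner ℝ (gradient φ a - gradient φ b) (a - b) ≤ L * ‖a - b‖ * ‖a - b‖ :=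
    (real_inner_le_norm _ _).trans (mul_le_mul_of_nonneg_right (hL a b) (norm_nonneg _))
  rw [inner_sub_left] at h4
  unfold bregman
  nlinarith

/-- The three-point identity. -/
theorem bregman_three_point (a b c : Vec n) :
    bregman φ a b = bregman φ a c + bregman φ c b
      + inner ℝ (gradient φ c - gradient φ b) (a - c) := by
  have : a - b = (a - c) + (c - b) := by abel
  unfold bregman
  rw [this, inner_add_right, inner_sub_left]
  ring

/-- Moving the base point of the divergence costs at most a multiple of the displacement. -/
theorem bregman_le_add_of_lipschitz (hφ : IsStronglyConvex φ σ) (hσ : 0 < σ)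
    (hL : ∀ a b : Vec n, ‖gradient φ a - gradient φ b‖ ≤ L * ‖a - b‖) (a b c : Vec n) :
    bregman φ a b ≤ bregman φ a c + L * ‖c - b‖ * (‖c - b‖ + ‖a - c‖) := by
  have h1 := bregman_le_of_lipschitz hφ hσ hL c b
  have h2 : inner ℝ (gradient φ c - gradient φ b) (a - c) ≤ L * ‖c - b‖ * ‖a - c‖ :=
    (real_inner_le_norm _ _).trans (mul_le_mul_of_nonneg_right (hL c b) (norm_nonneg _))
  rw [bregman_three_point a b c]
  nlinarith

/-- First-order optimality of a mirror descent step. Since `∇φ` is Lipschitz, moving from `u` a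
fraction `s` of the way to `v` changes the objective by the linear term and `O(s ^ 2)`, so no
differential calculus is needed. -/
theorem IsArgmin.mirror_optimality (hφ : IsStronglyConvex φ σ) (hσ : 0 < σ)
    (hL : ∀ a b : Vec n, ‖gradient φ a - gradient φ b‖ ≤ L * ‖a - b‖)
    {X : Set (Vec n)} (hX : Convex ℝ X) {p y u : Vec n} {a : ℝ} (ha : 0 < a)
    (hu : IsArgmin X (fun v => inner ℝ p v + bregman φ v y / a) u) {v : Vec n} (hv : v ∈ X) :
    0 ≤ inner ℝ (a • p + (gradient φ u - gradient φ y)) (v - u) := by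
  obtain ⟨huX, hmin⟩ := hu
  have key : ∀ s : ℝ, 0 < s → s ≤ 1 →
      0 ≤ inner ℝ (a • p + (gradient φ u - gradient φ y)) (v - u) + s * (L * ‖v - u‖ ^ 2) := by
    intro s hs hs1
    have hw : u + s • (v - u) ∈ X := hX.add_smul_sub_mem huX hv ⟨hs.le, hs1⟩
    have h1 := isMinOn_iff.1 hmin _ hw
    have h2 := bregman_three_point (φ := φ) (u + s • (v - u)) y u
    have h3 := bregman_le_of_lipschitz hφ hσ hL (u + s • (v - u)) u
    simp only [add_sub_cancel_left, norm_smul, inner_add_right, inner_smul_right,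
      Real.norm_eq_abs, mul_pow, sq_abs] at h1 h2 h3
    have h4 : bregman φ u y ≤ a * (s * inner ℝ p (v - u)) + bregman φ (u + s • (v - u)) y := by
      have := mul_le_mul_of_nonneg_left h1 ha.le
      rw [mul_add, mul_add, mul_div_cancel₀ _ ha.ne', mul_div_cancel₀ _ ha.ne'] at this
      linarith
    rw [inner_add_left, real_inner_smul_left]
    have h5 : 0 ≤ s * (a * inner ℝ p (v - u) + inner ℝ (gradient φ u - gradient φ y) (v - u)
        + s * (L * ‖v - u‖ ^ 2)) := by linarith
    exact nonneg_of_mul_nonneg_right h5 hs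
  have hlim : Tendsto (fun s : ℝ => inner ℝ (a • p + (gradient φ u - gradient φ y)) (v - u)
      + s * (L * ‖v - u‖ ^ 2)) (𝓝[>] 0)
      (𝓝 (inner ℝ (a • p + (gradient φ u - gradient φ y)) (v - u) + 0 * (L * ‖v - u‖ ^ 2))) :=
    ((continuous_const.add (continuous_id.mul continuous_const)).tendsto 0).mono_left
      nhdsWithin_le_nhds
  rw [zero_mul, add_zero] at hlim
  refine ge_of_tendsto hlim ?_
  filter_upwards [Ioc_mem_nhdsGT (zero_lt_one' ℝ)] with s hs using key s hs.1 hs.2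

/-- Two mirror descent steps from the same point in the same direction, with different
stepsizes, end at points whose distance is controlled by the difference of the stepsizes. -/
theorem IsArgmin.dist_mirror_le (hφ : IsStronglyConvex φ σ) (hσ : 0 < σ)
    (hL : ∀ a b : Vec n, ‖gradient φ a - gradient φ b‖ ≤ L * ‖a - b‖)
    {X : Set (Vec n)} (hX : Convex ℝ X) {p y u u' : Vec n} {a a' : ℝ} (ha : 0 < a) (ha' : 0 < a')
    (hu : IsArgmin X (fun v => inner ℝ p v + bregman φ v y / a) u)
    (hu' : IsArgmin X (fun v => inner ℝ p v + bregman φ v y / a') u') :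
    σ * ‖u - u'‖ ≤ |a - a'| * ‖p‖ := by
  have h1 := hu.mirror_optimality hφ hσ hL hX ha hu'.1
  have h2 := hu'.mirror_optimality hφ hσ hL hX ha' hu.1
  have h3 := hφ.monotone_gradient u u'
  have h4 : inner ℝ ((a' - a) • p) (u - u') ≤ |a - a'| * ‖p‖ * ‖u - u'‖ := by
    refine (real_inner_le_norm _ _).trans_eq ?_
    rw [norm_smul, Real.norm_eq_abs, abs_sub_comm]
  have h5 : σ * ‖u - u'‖ ^ 2 ≤ |a - a'| * ‖p‖ * ‖u - u'‖ := by
    have e : u' - u = -(u - u') := by abel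
    rw [e] at h1
    simp only [inner_neg_right, inner_add_left, inner_sub_left, real_inner_smul_left]
      at h1 h2 h3 h4
    linarith
  rcases (norm_nonneg (u - u')).eq_or_lt with h | h
  · rw [← h, mul_zero]; positivity
  · refine le_of_mul_le_mul_right ?_ h
    linarith

/-- A mirror descent step of size `a` in the direction `p` moves by at most `a ‖p‖ / σ`. -/
theorem IsArgmin.dist_mirror_center_le (hφ : IsStronglyConvex φ σ) (hσ : 0 < σ)
    (hL : ∀ a b : Vec n, ‖gradient φ a - gradient φ b‖ ≤ L * ‖a - b‖)
    {X : Set (Vec n)} (hX : Convex ℝ X) {p y u : Vec n} {a : ℝ} (ha : 0 < a)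
    (hu : IsArgmin X (fun v => inner ℝ p v + bregman φ v y / a) u) (hy : y ∈ X) :
    σ * ‖u - y‖ ≤ a * ‖p‖ := by
  have h1 := hu.mirror_optimality hφ hσ hL hX ha hy
  have h3 := hφ.monotone_gradient u y
  have h4 : inner ℝ (a • p) (y - u) ≤ a * ‖p‖ * ‖u - y‖ := by
    refine (real_inner_le_norm _ _).trans_eq ?_
    rw [norm_smul, Real.norm_eq_abs, abs_of_pos ha, norm_sub_rev]
  have h5 : σ * ‖u - y‖ ^ 2 ≤ a * ‖p‖ * ‖u - y‖ := by
    have e : y - u = -(u - y) := by abel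
    rw [e] at h1 h4
    simp only [inner_neg_right, inner_add_left, inner_sub_left, real_inner_smul_left]
      at h1 h3 h4
    linarith
  rcases (norm_nonneg (u - y)).eq_or_lt with h | h
  · rw [← h, mul_zero]; positivity
  · refine le_of_mul_le_mul_right ?_ h
    linarith

/-- The basic inequality of mirror descent. -/
theorem IsArgmin.bregman_mirror_le (hφ : IsStronglyConvex φ σ) (hσ : 0 < σ)
    (hL : ∀ a b : Vec n, ‖gradient φ a - gradient φ b‖ ≤ L * ‖a - b‖)
    {X : Set (Vec n)} (hX : Convex ℝ X) {p y u : Vec n} {a : ℝ} (ha : 0 < a)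
    (hu : IsArgmin X (fun v => inner ℝ p v + bregman φ v y / a) u) {v : Vec n} (hv : v ∈ X) :
    bregman φ v u ≤ bregman φ v y + a * inner ℝ p (v - u) := by
  have h1 := hu.mirror_optimality hφ hσ hL hX ha hv
  have h2 := bregman_three_point (φ := φ) v y u
  have h3 := hφ.bregman_nonneg hσ u y
  rw [inner_add_left, real_inner_smul_left] at h1
  linarith

end Bregman

/-! ### The quantizer -/

theorem abs_uniformQuantizer_sub_le {K : ℕ} (hK : 1 ≤ K) (z x : ℝ) {d : ℝ} (hd : 0 ≤ d) :
    |uniformQuantizer K z d x - z| ≤ d := by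
  have hK0 : (0 : ℝ) < K := by exact_mod_cast hK
  unfold uniformQuantizer
  split_ifs with h1 h2
  · rw [sub_sub_cancel_left, abs_neg, abs_of_nonneg hd]
  · rw [add_sub_cancel_left, abs_of_nonneg hd]
  · have hd0 : 0 < d := by linarith
    have hlow : 0 ≤ ⌊(x - z + d) * K / (2 * d)⌋ :=
      Int.floor_nonneg.2 (div_nonneg (mul_nonneg (by linarith) hK0.le) (by linarith))
    have hup : ⌊(x - z + d) * K / (2 * d)⌋ ≤ (K : ℤ) := by
      rw [← Int.floor_natCast (R := ℝ)]
      refine Int.floor_mono ?_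
      rw [div_le_iff₀ (by linarith)]
      nlinarith
    have hlow' : (0 : ℝ) ≤ (⌊(x - z + d) * K / (2 * d)⌋ : ℝ) := by exact_mod_cast hlow
    have hup' : (⌊(x - z + d) * K / (2 * d)⌋ : ℝ) ≤ (K : ℝ) := by exact_mod_cast hup
    rw [add_sub_cancel_left, abs_le, div_le_iff₀ hK0, le_div_iff₀ hK0]
    constructor <;> nlinarith

/-- Whatever the input, the quantizer returns a point within `d` of `z` in each coordinate. -/
theorem norm_vecQuantizer_sub_le {n K : ℕ} (hK : 1 ≤ K) (z x : Vec n) {d : ℝ} (hd : 0 ≤ d) :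
    ‖vecQuantizer K z (WithLp.toLp 2 fun _ => d) x - z‖ ≤ n * d := by
  have h : ∀ k, ‖(vecQuantizer K z (WithLp.toLp 2 fun _ => d) x - z) k‖ ≤ d := fun k => by
    simpa [vecQuantizer] using abs_uniformQuantizer_sub_le hK (z k) (x k) hd
  rw [EuclideanSpace.norm_eq]
  refine Real.sqrt_le_iff.2 ⟨by positivity, ?_⟩
  calc ∑ k, ‖(vecQuantizer K z (WithLp.toLp 2 fun _ => d) x - z) k‖ ^ 2
      ≤ ∑ _k : Fin n, d ^ 2 := Finset.sum_le_sum fun k _ =>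
        pow_le_pow_left₀ (norm_nonneg _) (h k) 2
    _ = n * d ^ 2 := by simp
    _ ≤ (n * d) ^ 2 := by
      rw [mul_pow]
      refine mul_le_mul_of_nonneg_right ?_ (sq_nonneg d)
      exact_mod_cast Nat.le_self_pow two_ne_zero n

/-! ### Consensus -/

section Consensus

variable {N : ℕ} {P : ℕ → Matrix (Fin N) (Fin N) ℝ} {θ : ℝ} {B : ℕ}

/-- The transition matrix `P (s + k - 1) ⋯ P (s + 1) P s` of `k` steps from time `s` on. -/
def transition (P : ℕ → Matrix (Fin N) (Fin N) ℝ) (s : ℕ) : ℕ → Matrix (Fin N) (Fin N) ℝ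
  | 0 => 1
  | k + 1 => P (s + k) * transition P s k

theorem transition_mem (hP : ∀ t, P t ∈ doublyStochastic ℝ (Fin N)) (s k : ℕ) :
    transition P s k ∈ doublyStochastic ℝ (Fin N) := by
  induction k with
  | zero => exact one_mem _
  | succ k ih => exact mul_mem (hP _) ih

/-- The agents that information from agent `m` at time `s` has reached after `k` steps: those
whose entry in the transition matrix is at least `θ ^ k`. -/
noncomputable def reached (P : ℕ → Matrix (Fin N) (Fin N) ℝ) (θ : ℝ) (s : ℕ) (m : Fin N) (k : ℕ) :
    Finset (Fin N) :=
  open Classical in Finset.univ.filter fun i => θ ^ k ≤ transition P s k i m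

theorem mem_reached {s k : ℕ} {m i : Fin N} :
    i ∈ reached P θ s m k ↔ θ ^ k ≤ transition P s k i m := by
  simp [reached]

theorem mem_reached_succ (hP : ∀ t, P t ∈ doublyStochastic ℝ (Fin N)) (hθ : 0 < θ)
    {s k : ℕ} {m i j : Fin N} (hij : θ ≤ P (s + k) i j) (hj : j ∈ reached P θ s m k) :
    i ∈ reached P θ s m (k + 1) := by
  rw [mem_reached] at hj ⊢
  have hnn : ∀ a, 0 ≤ P (s + k) i a * transition P s k a m := fun a =>
    mul_nonneg (nonneg_of_mem_doublyStochastic (hP _))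
      (nonneg_of_mem_doublyStochastic (transition_mem hP s k))
  calc θ ^ (k + 1) = θ * θ ^ k := pow_succ' θ k
    _ ≤ P (s + k) i j * transition P s k j m :=
      mul_le_mul hij hj (by positivity) (hθ.le.trans hij)
    _ ≤ ∑ a, P (s + k) i a * transition P s k a m :=
      Finset.single_le_sum (f := fun a => P (s + k) i a * transition P s k a m)
        (fun a _ => hnn a) (Finset.mem_univ j)

theorem reached_mono (hP : ∀ t, P t ∈ doublyStochastic ℝ (Fin N)) (hθ : 0 < θ)
    (hdiag : ∀ t i, θ ≤ P t i i) (s : ℕ) (m : Fin N) : Monotone (reached P θ s m) :=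
  monotone_nat_of_le_succ fun k i hi => mem_reached_succ hP hθ (hdiag (s + k) i) hi

/-- Unless everybody has been reached, a full connectivity window reaches somebody new: a path
from a reached agent to one that is not has an edge that leaves the reached set. -/
theorem card_reached_lt (hP : ∀ t, P t ∈ doublyStochastic ℝ (Fin N)) (hθ : 0 < θ)
    (hedge : ∀ t i j, Connected P t j i → θ ≤ P t i j) (hdiag : ∀ t i, θ ≤ P t i i)
    (hconn : JointlyStronglyConnected P B) {s k c : ℕ} {m : Fin N} (hk : s + k = c * B + 1)
    (hm : m ∈ reached P θ s m k) (hne : reached P θ s m k ≠ Finset.univ) :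
    (reached P θ s m k).card < (reached P θ s m (k + B)).card := by
  have hmono := reached_mono hP hθ hdiag s m
  refine Finset.card_lt_card ((hmono (Nat.le_add_right k B)).ssubset_of_ne fun heq => ?_)
  obtain ⟨v, hv⟩ : ∃ v, v ∉ reached P θ s m k := by
    by_contra! h
    exact hne (Finset.eq_univ_iff_forall.2 h)
  refine hv ?_
  have hpath := hconn c m v
  clear hv
  induction hpath with
  | refl => exact hm
  | tail _ hstep ih =>
    obtain ⟨t, ht, hadj⟩ := hstep
    rw [Finset.mem_Icc, add_mul, one_mul] at ht
    obtain ⟨r, rfl⟩ : ∃ r, t = s + (k + r) := ⟨t - (s + k), by omega⟩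
    rw [heq]
    exact hmono (show k + r + 1 ≤ k + B by omega)
      (mem_reached_succ hP hθ (hedge _ _ _ hadj) (hmono (Nat.le_add_right k r) ih))

/-- Over `(N + 1) B` steps, which contain `N` full connectivity windows wherever they start, the
transition matrix becomes uniformly positive. -/
theorem pow_le_transition (hP : ∀ t, P t ∈ doublyStochastic ℝ (Fin N)) (hθ : 0 < θ)
    (hedge : ∀ t i j, Connected P t j i → θ ≤ P t i j) (hdiag : ∀ t i, θ ≤ P t i i)
    (hB : 1 ≤ B) (hconn : JointlyStronglyConnected P B) (s : ℕ) (i m : Fin N) :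
    θ ^ ((N + 1) * B) ≤ transition P s ((N + 1) * B) i m := by
  have hmono := reached_mono hP hθ hdiag s m
  have hm0 : m ∈ reached P θ s m 0 := by simp [mem_reached, transition]
  obtain ⟨c, k, hk, hkB⟩ : ∃ c k, s + k = c * B + 1 ∧ k ≤ B := by
    have h1 := Nat.div_add_mod (s + B - 1) B
    have h2 := Nat.mod_lt (s + B - 1) hB
    rw [mul_comm] at h1
    exact ⟨(s + B - 1) / B, (s + B - 1) / B * B + 1 - s, by omega, by omega⟩
  have hcard : ∀ r, min N r ≤ (reached P θ s m (k + r * B)).card := by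
    intro r
    induction r with
    | zero => simp
    | succ r ih =>
      rw [show k + (r + 1) * B = k + r * B + B by ring]
      by_cases hne : reached P θ s m (k + r * B) = Finset.univ
      · have : (reached P θ s m (k + r * B)).card ≤ (reached P θ s m (k + r * B + B)).card :=
          Finset.card_le_card (hmono (Nat.le_add_right _ _))
        rw [hne, Finset.card_univ, Fintype.card_fin] at this
        omega
      · have := card_reached_lt hP hθ hedge hdiag hconn (c := c + r)
          (show s + (k + r * B) = (c + r) * B + 1 by rw [add_mul]; omega)
          (hmono (Nat.zero_le _) hm0) hne
        omega
  have hfull : reached P θ s m (k + N * B) = Finset.univ := by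
    rw [← Finset.card_eq_iff_eq_univ, Fintype.card_fin]
    refine le_antisymm ?_ (by simpa using hcard N)
    simpa using Finset.card_le_univ (reached P θ s m (k + N * B))
  rw [← mem_reached]
  exact hmono (show k + N * B ≤ (N + 1) * B by rw [add_mul]; omega) (hfull ▸ Finset.mem_univ i)

variable {E : Type*} [NormedAddCommGroup E] [NormedSpace ℝ E]

/-- Averaging with two probability vectors `a`, `b`, one of which has all weights at least `η`,
contracts the diameter by `1 - η`: couple the two averages independently, and use that the
diagonal of the product weights has mass at least `η`. -/
theorem norm_sum_smul_sub_sum_smul_le {ι : Type*} [Fintype ι] {a b : ι → ℝ} {v : ι → E}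
    {η A : ℝ} (ha : ∀ j, η ≤ a j) (ha0 : ∀ j, 0 ≤ a j) (hb : ∀ j, 0 ≤ b j) (ha1 : ∑ j, a j = 1)
    (hb1 : ∑ j, b j = 1) (hA : 0 ≤ A) (hv : ∀ j k, ‖v j - v k‖ ≤ A) :
    ‖∑ j, a j • v j - ∑ k, b k • v k‖ ≤ (1 - η) * A := by
  classical
  have e1 : ∑ j, a j • v j - ∑ k, b k • v k = ∑ j, ∑ k, (a j * b k) • (v j - v k) := by
    simp only [smul_sub, Finset.sum_sub_distrib]
    congr 1
    · refine Finset.sum_congr rfl fun j _ => ?_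
      rw [← Finset.sum_smul, ← Finset.mul_sum, hb1, mul_one]
    · rw [Finset.sum_comm]
      refine Finset.sum_congr rfl fun k _ => ?_
      rw [← Finset.sum_smul, ← Finset.sum_mul, ha1, one_mul]
  have e2 : ∑ j, ∑ k, (a j * b k) * (A - if j = k then A else 0)
      = A - (∑ k, a k * b k) * A := by
    simp only [mul_sub, Finset.sum_sub_distrib, mul_ite, mul_zero, Finset.sum_ite_eq,
      Finset.mem_univ, if_true]
    rw [← Finset.sum_mul]
    congr 1
    simp_rw [← Finset.sum_mul, ← Finset.mul_sum, hb1, mul_one, ha1, one_mul]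
  have h3 : η ≤ ∑ k, a k * b k := by
    calc η = ∑ k, η * b k := by rw [← Finset.mul_sum, hb1, mul_one]
      _ ≤ _ := Finset.sum_le_sum fun k _ => mul_le_mul_of_nonneg_right (ha k) (hb k)
  calc ‖∑ j, a j • v j - ∑ k, b k • v k‖
      ≤ ∑ j, ∑ k, (a j * b k) * (A - if j = k then A else 0) := by
        rw [e1]
        refine norm_sum_le_of_le _ fun j _ => norm_sum_le_of_le _ fun k _ => ?_
        rw [norm_smul, Real.norm_of_nonneg (mul_nonneg (ha0 j) (hb k))]
        refine mul_le_mul_of_nonneg_left ?_ (mul_nonneg (ha0 j) (hb k))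
        split_ifs with h
        · simp [h]
        · simpa using hv j k
    _ ≤ (1 - η) * A := by
        rw [e2]
        nlinarith

theorem norm_sum_smul_le_of_sum_eq_one {ι : Type*} [Fintype ι] {a : ι → ℝ} {v : ι → E} {A : ℝ}
    (ha : ∀ j, 0 ≤ a j) (ha1 : ∑ j, a j = 1) (hv : ∀ j, ‖v j‖ ≤ A) :
    ‖∑ j, a j • v j‖ ≤ A := by
  calc ‖∑ j, a j • v j‖ ≤ ∑ j, a j * A := norm_sum_le_of_le _ fun j _ => by
        rw [norm_smul, Real.norm_of_nonneg (ha j)]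
        exact mul_le_mul_of_nonneg_left (hv j) (ha j)
    _ = A := by rw [← Finset.sum_mul, ha1, one_mul]

/-- A perturbed averaging recursion deviates from the unperturbed one by the accumulated
perturbations. -/
theorem norm_sub_transition_le (hP : ∀ t, P t ∈ doublyStochastic ℝ (Fin N))
    {x : Fin N → ℕ → E} {ρ : ℕ → ℝ}
    (hx : ∀ i t, ‖x i (t + 1) - ∑ j, P t i j • x j t‖ ≤ ρ t) (s k : ℕ) (i : Fin N) :
    ‖x i (s + k) - ∑ j, transition P s k i j • x j s‖ ≤ ∑ r ∈ Finset.range k, ρ (s + r) := by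
  induction k generalizing i with
  | zero => simp [transition, Matrix.one_apply]
  | succ k ih =>
    have e : x i (s + (k + 1)) - ∑ j, transition P s (k + 1) i j • x j s
        = ∑ a, P (s + k) i a • (x a (s + k) - ∑ j, transition P s k a j • x j s)
          + (x i (s + k + 1) - ∑ j, P (s + k) i j • x j (s + k)) := by
      simp only [transition, Matrix.mul_apply, smul_sub, Finset.sum_sub_distrib, Finset.smul_sum,
        smul_smul, Finset.sum_smul]
      rw [Finset.sum_comm (γ := Fin N)]
      simp only [← add_assoc]
      abel
    rw [e, Finset.sum_range_succ]
    exact (norm_add_le _ _).trans (add_le_add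
      (norm_sum_smul_le_of_sum_eq_one (fun j => nonneg_of_mem_doublyStochastic (hP _))
        (sum_row_of_mem_doublyStochastic (hP _) i) ih) (hx i (s + k)))

/-- Agents that average over a jointly strongly connected network, up to perturbations that tend
to zero, reach consensus. -/
theorem tendsto_norm_sub_of_averaging (hP : ∀ t, P t ∈ doublyStochastic ℝ (Fin N))
    (hθ : θ ∈ Set.Ioo (0 : ℝ) 1)
    (hedge : ∀ t i j, Connected P t j i → θ ≤ P t i j) (hdiag : ∀ t i, θ ≤ P t i i)
    (hB : 1 ≤ B) (hconn : JointlyStronglyConnected P B)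
    {x : Fin N → ℕ → E} {A : ℝ} (hA : 0 ≤ A) (hbdd : ∀ i j t, ‖x i t - x j t‖ ≤ A) {ρ : ℕ → ℝ}
    (hx : ∀ i t, ‖x i (t + 1) - ∑ j, P t i j • x j t‖ ≤ ρ t) (hρ : Tendsto ρ atTop (𝓝 0))
    (i j : Fin N) : Tendsto (fun t => ‖x i t - x j t‖) atTop (𝓝 0) := by
  set M := (N + 1) * B
  have hη : 0 < θ ^ M := pow_pos hθ.1 M
  have hη1 : θ ^ M ≤ 1 := pow_le_one₀ hθ.1.le hθ.2.le
  have hstep : ∀ s C, 0 ≤ C → (∀ i j, ‖x i s - x j s‖ ≤ C) → ∀ i j,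
      ‖x i (s + M) - x j (s + M)‖
        ≤ (1 - θ ^ M) * C + 2 * ∑ r ∈ Finset.range M, ρ (s + r) := by
    intro s C hC hs i j
    have h1 := norm_sub_transition_le hP hx s M i
    have h2 := norm_sub_transition_le hP hx s M j
    have hW := transition_mem hP s M
    have h3 := norm_sum_smul_sub_sum_smul_le (v := fun j => x j s)
      (pow_le_transition hP hθ.1 hedge hdiag hB hconn s i)
      (fun _ => nonneg_of_mem_doublyStochastic hW) (fun _ => nonneg_of_mem_doublyStochastic hW)
      (sum_row_of_mem_doublyStochastic hW i) (sum_row_of_mem_doublyStochastic hW j) hC hs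
    rw [norm_sub_rev] at h2
    have e : x i (s + M) - x j (s + M)
        = (x i (s + M) - ∑ j, transition P s M i j • x j s)
          + (∑ k, transition P s M i k • x k s - ∑ k, transition P s M j k • x k s)
          + (∑ k, transition P s M j k • x k s - x j (s + M)) := by abel
    rw [e]
    refine (norm_add₃_le).trans ?_
    linarith
  have hsum : Tendsto (fun s => 2 * ∑ r ∈ Finset.range M, ρ (s + r)) atTop (𝓝 0) := by
    have : Tendsto (fun s => ∑ r ∈ Finset.range M, ρ (s + r)) atTop
        (𝓝 (∑ _r ∈ Finset.range M, (0 : ℝ))) :=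
      tendsto_finsetSum _ fun r _ => hρ.comp (tendsto_add_atTop_nat r)
    simpa using this.const_mul 2
  -- Iterating the contraction: each block of `M` steps multiplies the transient by `1 - θ ^ M`.
  have hev : ∀ ε > 0, ∀ k : ℕ, ∀ᶠ s in atTop, ∀ i j,
      ‖x i s - x j s‖ ≤ (1 - θ ^ M) ^ k * A + ε := by
    intro ε hε k
    induction k with
    | zero =>
      refine Eventually.of_forall fun s i j => ?_
      rw [pow_zero, one_mul]
      linarith [hbdd i j s]
    | succ k ih =>
      have hsmall := hsum.eventually (gt_mem_nhds (show 0 < θ ^ M * ε by positivity))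
      obtain ⟨s₀, hs₀⟩ := eventually_atTop.1 (ih.and hsmall)
      refine eventually_atTop.2 ⟨s₀ + M, fun t ht i j => ?_⟩
      obtain ⟨s, rfl⟩ : ∃ s, t = s + M := ⟨t - M, by omega⟩
      obtain ⟨h1, h2⟩ := hs₀ s (by omega)
      have hpow : 0 ≤ (1 - θ ^ M) ^ k := pow_nonneg (by linarith) k
      have := hstep s _ (by positivity) h1 i j
      rw [pow_succ']
      linarith
  have hpow : Tendsto (fun k : ℕ => (1 - θ ^ M) ^ k * A) atTop (𝓝 0) := by
    simpa using (tendsto_pow_atTop_nhds_zero_of_lt_one (by linarith : 0 ≤ 1 - θ ^ M)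
      (by linarith)).mul_const A
  refine Metric.tendsto_nhds.2 fun ε hε => ?_
  obtain ⟨k, hk⟩ := (hpow.eventually (gt_mem_nhds (half_pos hε))).exists
  filter_upwards [hev (ε / 4) (by positivity) k] with s hs
  rw [Real.dist_0_eq_abs, abs_norm]
  linarith [hs i j]

end Consensus

/-! ### Averages and telescoping sums -/

/-- A non-increasing non-negative sequence whose (shifted) averages tend to zero tends to zero. -/
theorem tendsto_zero_of_antitone_of_average {α : ℕ → ℝ} (hα : ∀ t, 0 ≤ α t)
    (hmono : Antitone α) (τ : ℕ)
    (h : Tendsto (fun T : ℕ => 1 / (T : ℝ) * ∑ t ∈ Finset.Icc 1 (T + τ), α t) atTop (𝓝 0)) :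
    Tendsto α atTop (𝓝 0) := by
  refine squeeze_zero' (Eventually.of_forall hα) ?_ h
  filter_upwards [eventually_gt_atTop 0] with T hT
  have hT0 : (0 : ℝ) < T := by exact_mod_cast hT
  rw [one_div, inv_mul_eq_div, le_div_iff₀ hT0]
  calc α T * T = ∑ _t ∈ Finset.Icc 1 T, α T := by simp [mul_comm]
    _ ≤ ∑ t ∈ Finset.Icc 1 T, α t :=
      Finset.sum_le_sum fun t ht => hmono (Finset.mem_Icc.1 ht).2
    _ ≤ ∑ t ∈ Finset.Icc 1 (T + τ), α t :=
      Finset.sum_le_sum_of_subset_of_nonneg (Finset.Icc_subset_Icc_right (by omega))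
        fun t _ _ => hα t

/-- Summation by parts for differences of a bounded sequence `S` weighted with the non-decreasing
weights `1 / α`. The total is governed by the last weight alone. -/
theorem sum_le_of_telescoping {α S e h : ℕ → ℝ} {M C : ℝ} {τ : ℕ} (hα : ∀ t, 0 < α t)
    (hmono : Antitone α) (hC : 0 ≤ C) (hSM : ∀ t, S t ≤ M)
    (hh : ∀ s, h s ≤ (S (s + τ) - S (s + τ + 1)) / α (s + τ + 1)
      + C * (1 / α (s + τ + 1) - 1 / α (s + τ)) + e s) (T : ℕ) :
    ∑ s ∈ Finset.range T, h s
      ≤ (M + C - S (T + τ)) / α (T + τ) + ∑ s ∈ Finset.range T, e s := by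
  induction T with
  | zero =>
    simp only [Finset.range_zero, Finset.sum_empty, add_zero]
    exact div_nonneg (by linarith [hSM (0 + τ)]) (hα _).le
  | succ T ih =>
    rw [Finset.sum_range_succ, Finset.sum_range_succ, show T + 1 + τ = T + τ + 1 by ring]
    have h1 := hh T
    have h2 : 1 / α (T + τ) ≤ 1 / α (T + τ + 1) :=
      one_div_le_one_div_of_le (hα _) (hmono (Nat.le_succ _))
    have h3 := mul_le_mul_of_nonneg_left h2 (sub_nonneg.2 (hSM (T + τ)))
    simp only [div_eq_mul_inv, one_mul] at h1 h3 ih ⊢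
    linarith

/-! ### Estimates along a run of the algorithm -/

section Run

variable {N n : ℕ} {X : Set (Vec n)} {f : Fin N → Vec n → ℝ} {φ : Vec n → ℝ} {σ G L : ℝ}
  {K τ : ℕ} {P : ℕ → Matrix (Fin N) (Fin N) ℝ} {α β : ℕ → ℝ} {x z y : Fin N → ℕ → Vec n}
  {ytil g : Fin N → ℤ → Vec n}

theorem IsAlgorithmRun.x_mem (h : IsAlgorithmRun X f φ σ G K τ P α β x z y ytil g) (i : Fin N)
    (t : ℕ) : x i t ∈ X := by
  cases t with
  | zero => exact h.init_x i
  | succ t => exact (h.step_x i t).1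

theorem sum_smul_mem_of_doublyStochastic (hX : Convex ℝ X)
    (hP : ∀ t, P t ∈ doublyStochastic ℝ (Fin N)) (t : ℕ) (i : Fin N) {v : Fin N → Vec n}
    (hv : ∀ j, v j ∈ X) : ∑ j, P t i j • v j ∈ X :=
  hX.sum_mem (fun _ _ => nonneg_of_mem_doublyStochastic (hP t))
    (sum_row_of_mem_doublyStochastic (hP t) i) fun j _ => hv j

/-- The two mirror descent steps stay within the quantization interval of each other: this is
why the interval size `G α β / σ` is the right one. -/
theorem IsAlgorithmRun.norm_x_sub_z_le (h : IsAlgorithmRun X f φ σ G K τ P α β x z y ytil g)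
    (hX : Convex ℝ X) (hφ : IsStronglyConvex φ σ) (hσ : 0 < σ)
    (hL : ∀ a b : Vec n, ‖gradient φ a - gradient φ b‖ ≤ L * ‖a - b‖)
    (hα : ∀ t, α t ∈ Set.Ioo (0 : ℝ) 1) (hβ : ∀ t, β t ∈ Set.Ioo (0 : ℝ) 1) (hG0 : 0 ≤ G)
    (hG : ∀ i, ∀ t : ℕ, ‖g i ((t : ℤ) - τ)‖ ≤ G) (i : Fin N) (t : ℕ) :
    ‖x i t - z i t‖ ≤ G * α t * β t / σ := by
  have hαt := (hα t).1
  have hβt := (hβ t).1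
  cases t with
  | zero =>
    rw [h.init_z, sub_self, norm_zero]
    positivity
  | succ t =>
    have h1 := (h.step_x i t).dist_mirror_le hφ hσ hL hX hαt
      (mul_pos hαt (sub_pos.2 (hβ _).2)) (h.step_z i t)
    rw [show α (t + 1) - α (t + 1) * (1 - β (t + 1)) = α (t + 1) * β (t + 1) by ring,
      abs_of_pos (mul_pos hαt hβt)] at h1
    rw [le_div_iff₀ hσ]
    have := mul_le_mul_of_nonneg_left (hG i t) (mul_pos hαt hβt).le
    linarith

/-- The projected points differ from exact averages of the states by a multiple of the
quantization interval size. -/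
theorem IsAlgorithmRun.norm_average_sub_ytil_le
    (h : IsAlgorithmRun X f φ σ G K τ P α β x z y ytil g) (hK : 1 ≤ K)
    (hX : Convex ℝ X) (hP : ∀ t, P t ∈ doublyStochastic ℝ (Fin N))
    (hφ : IsStronglyConvex φ σ) (hσ : 0 < σ)
    (hL : ∀ a b : Vec n, ‖gradient φ a - gradient φ b‖ ≤ L * ‖a - b‖)
    (hα : ∀ t, α t ∈ Set.Ioo (0 : ℝ) 1) (hβ : ∀ t, β t ∈ Set.Ioo (0 : ℝ) 1) (hG0 : 0 ≤ G)
    (hG : ∀ i, ∀ t : ℕ, ‖g i ((t : ℤ) - τ)‖ ≤ G) (i : Fin N) (t : ℕ) :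
    ‖∑ j, P t i j • x j t - ytil i t‖ ≤ 2 * ((n + 1) * G / σ) * (α t * β t) := by
  have hαt := (hα t).1
  have hβt := (hβ t).1
  have hq : ∀ j, ‖vecQuantizer K (z j t) (intervalSize n G σ α β t) (x j t) - x j t‖
      ≤ (n + 1) * (G * α t * β t / σ) := fun j => by
    have h1 := norm_vecQuantizer_sub_le hK (z j t) (x j t)
      (show 0 ≤ G * α t * β t / σ by positivity)
    have h2 := h.norm_x_sub_z_le hX hφ hσ hL hα hβ hG0 hG j t
    rw [norm_sub_rev] at h2
    have h3 := norm_sub_le_norm_sub_add_norm_sub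
      (vecQuantizer K (z j t) (intervalSize n G σ α β t) (x j t)) (z j t) (x j t)
    unfold intervalSize at h3 ⊢
    linarith
  have hw : ‖y i t - ∑ j, P t i j • x j t‖ ≤ (n + 1) * (G * α t * β t / σ) := by
    rw [h.step_y i t, ← Finset.sum_sub_distrib]
    simp only [← smul_sub]
    exact norm_sum_smul_le_of_sum_eq_one (fun _ => nonneg_of_mem_doublyStochastic (hP t))
      (sum_row_of_mem_doublyStochastic (hP t) i) hq
  -- The average lies in `X`, so that the projection is at least as close to `y` as the average.
  have hmin : ‖ytil i t - y i t‖ ≤ ‖∑ j, P t i j • x j t - y i t‖ :=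
    isMinOn_iff.1 (h.step_ytil i t).2 _
      (sum_smul_mem_of_doublyStochastic hX hP t i fun j => h.x_mem j t)
  rw [norm_sub_rev] at hw hmin
  have h3 := norm_sub_le_norm_sub_add_norm_sub (∑ j, P t i j • x j t) (y i t) (ytil i t)
  have e : 2 * ((n + 1) * G / σ) * (α t * β t) = 2 * ((n + 1) * (G * α t * β t / σ)) := by ring
  linarith

theorem IsAlgorithmRun.norm_x_succ_sub_ytil_le
    (h : IsAlgorithmRun X f φ σ G K τ P α β x z y ytil g)
    (hX : Convex ℝ X) (hφ : IsStronglyConvex φ σ) (hσ : 0 < σ)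
    (hL : ∀ a b : Vec n, ‖gradient φ a - gradient φ b‖ ≤ L * ‖a - b‖)
    (hα : ∀ t, α t ∈ Set.Ioo (0 : ℝ) 1)
    (hG : ∀ i, ∀ t : ℕ, ‖g i ((t : ℤ) - τ)‖ ≤ G) (i : Fin N) (t : ℕ) :
    ‖x i (t + 1) - ytil i t‖ ≤ G / σ * α (t + 1) := by
  have h1 := (h.step_x i t).dist_mirror_center_le hφ hσ hL hX (hα _).1 (h.step_ytil i t).1
  have h2 := mul_le_mul_of_nonneg_left (hG i t) (hα (t + 1)).1.le
  rw [div_mul_eq_mul_div, le_div_iff₀ hσ]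
  linarith

/-- Since all parameters tend to zero, the agents reach consensus, and a bounded number of steps
moves nobody by a non-vanishing amount: the projected point of any agent and the state of any
agent a fixed number of steps later merge. -/
theorem IsAlgorithmRun.tendsto_norm_ytil_sub_x
    (h : IsAlgorithmRun X f φ σ G K τ P α β x z y ytil g) (hK : 1 ≤ K)
    (hX : Convex ℝ X) {A : ℝ} (hA : ∀ a ∈ X, ∀ b ∈ X, ‖a - b‖ ≤ A)
    (hP : ∀ t, P t ∈ doublyStochastic ℝ (Fin N)) {θ : ℝ} (hθ : θ ∈ Set.Ioo (0 : ℝ) 1)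
    (hedge : ∀ t i j, Connected P t j i → θ ≤ P t i j) (hdiag : ∀ t i, θ ≤ P t i i)
    {B : ℕ} (hB : 1 ≤ B) (hconn : JointlyStronglyConnected P B)
    (hφ : IsStronglyConvex φ σ) (hσ : 0 < σ)
    (hL : ∀ a b : Vec n, ‖gradient φ a - gradient φ b‖ ≤ L * ‖a - b‖)
    (hα : ∀ t, α t ∈ Set.Ioo (0 : ℝ) 1) (hβ : ∀ t, β t ∈ Set.Ioo (0 : ℝ) 1) (hG0 : 0 ≤ G)
    (hG : ∀ i, ∀ t : ℕ, ‖g i ((t : ℤ) - τ)‖ ≤ G)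
    (hα0 : Tendsto α atTop (𝓝 0)) (hβ0 : Tendsto β atTop (𝓝 0)) (i j : Fin N) (k : ℕ) :
    Tendsto (fun s : ℕ => ‖ytil i s - x j (s + k + 1)‖) atTop (𝓝 0) := by
  have hα1 : Tendsto (fun t => α (t + 1)) atTop (𝓝 0) := hα0.comp (tendsto_add_atTop_nat 1)
  have hκ : Tendsto (fun t => 2 * ((n + 1) * G / σ) * (α t * β t)) atTop (𝓝 0) := by
    simpa using (hα0.mul hβ0).const_mul (2 * ((n + 1) * G / σ))
  have hμ : Tendsto (fun t => G / σ * α (t + 1)) atTop (𝓝 0) := by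
    simpa using hα1.const_mul (G / σ)
  have hx : ∀ i t, ‖x i (t + 1) - ∑ j, P t i j • x j t‖
      ≤ G / σ * α (t + 1) + 2 * ((n + 1) * G / σ) * (α t * β t) := fun i t => by
    have h1 := h.norm_x_succ_sub_ytil_le hX hφ hσ hL hα hG i t
    have h2 := h.norm_average_sub_ytil_le hK hX hP hφ hσ hL hα hβ hG0 hG i t
    rw [norm_sub_rev] at h2
    exact (norm_sub_le_norm_sub_add_norm_sub _ (ytil i t) _).trans (add_le_add h1 h2)
  have hρ : Tendsto (fun t => G / σ * α (t + 1) + 2 * ((n + 1) * G / σ) * (α t * β t)) atTop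
      (𝓝 0) := by simpa using hμ.add hκ
  have hA0 : 0 ≤ A := (norm_nonneg _).trans (hA _ (h.x_mem i 0) _ (h.x_mem i 0))
  have hcons := tendsto_norm_sub_of_averaging hP hθ hedge hdiag hB hconn hA0
    (fun i j t => hA _ (h.x_mem i t) _ (h.x_mem j t)) hx hρ
  have hsum : ∀ i, Tendsto (fun t => ∑ j, ‖x j t - x i t‖) atTop (𝓝 0) := fun i => by
    simpa using tendsto_finsetSum Finset.univ fun j _ => hcons j i
  have hmove : ∀ i, Tendsto (fun t => ‖x i t - x i (t + 1)‖) atTop (𝓝 0) := fun i => by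
    refine squeeze_zero (fun _ => norm_nonneg _) (fun t => ?_)
      (by simpa using hρ.add (hsum i))
    have h1 : ‖∑ j, P t i j • x j t - x i t‖ ≤ ∑ j, ‖x j t - x i t‖ := by
      have e : ∑ j, P t i j • x j t - x i t = ∑ j, P t i j • (x j t - x i t) := by
        simp only [smul_sub, Finset.sum_sub_distrib]
        rw [← Finset.sum_smul, sum_row_of_mem_doublyStochastic (hP t) i, one_smul]
      rw [e]
      exact norm_sum_smul_le_of_sum_eq_one (fun _ => nonneg_of_mem_doublyStochastic (hP t))
        (sum_row_of_mem_doublyStochastic (hP t) i) fun j =>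
          Finset.single_le_sum (f := fun j => ‖x j t - x i t‖) (fun _ _ => norm_nonneg _)
            (Finset.mem_univ j)
    rw [norm_sub_rev]
    exact (norm_sub_le_norm_sub_add_norm_sub _ _ _).trans (add_le_add (hx i t) h1)
  induction k with
  | zero =>
    have hl : Tendsto (fun t => G / σ * α (t + 1) + ‖x i (t + 1) - x j (t + 1)‖) atTop
        (𝓝 0) := by
      simpa using hμ.add ((hcons i j).comp (tendsto_add_atTop_nat 1))
    refine squeeze_zero (fun _ => norm_nonneg _) (fun t => ?_) hl
    have h1 := h.norm_x_succ_sub_ytil_le hX hφ hσ hL hα hG i t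
    rw [norm_sub_rev] at h1
    exact (norm_sub_le_norm_sub_add_norm_sub _ (x i (t + 1)) _).trans (by simpa using h1)
  | succ k ih =>
    have hl : Tendsto (fun s : ℕ => ‖ytil i s - x j (s + k + 1)‖
        + ‖x j (s + k + 1) - x j (s + k + 1 + 1)‖) atTop (𝓝 0) := by
      simpa [← add_assoc] using ih.add ((hmove j).comp (tendsto_add_atTop_nat (k + 1)))
    exact squeeze_zero (fun _ => norm_nonneg _)
      (fun _ => norm_sub_le_norm_sub_add_norm_sub _ _ _) hl

/-- One step of the algorithm, measured by the total divergence from a comparison point. -/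
theorem IsAlgorithmRun.sum_bregman_succ_le
    (h : IsAlgorithmRun X f φ σ G K τ P α β x z y ytil g) (hK : 1 ≤ K)
    (hX : Convex ℝ X) {A : ℝ} (hA : ∀ a ∈ X, ∀ b ∈ X, ‖a - b‖ ≤ A)
    (hP : ∀ t, P t ∈ doublyStochastic ℝ (Fin N))
    (hφ : IsStronglyConvex φ σ) (hσ : 0 < σ) (hL0 : 0 ≤ L)
    (hL : ∀ a b : Vec n, ‖gradient φ a - gradient φ b‖ ≤ L * ‖a - b‖)
    (hsep : SeparatelyConvex N φ)
    (hα : ∀ t, α t ∈ Set.Ioo (0 : ℝ) 1) (hβ : ∀ t, β t ∈ Set.Ioo (0 : ℝ) 1) (hG0 : 0 ≤ G)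
    (hG : ∀ i, ∀ t : ℕ, ‖g i ((t : ℤ) - τ)‖ ≤ G) {p : Vec n} (hp : p ∈ X) (t : ℕ) :
    ∑ i, bregman φ p (x i (t + 1)) ≤ ∑ i, bregman φ p (x i t)
      + α (t + 1) * ∑ i, inner ℝ (g i ((t : ℤ) - τ)) (p - x i (t + 1))
      + N * (L * (2 * ((n + 1) * G / σ)) * (2 * A)) * (α t * β t) := by
  have hαβ : 0 ≤ α t * β t := mul_nonneg (hα t).1.le (hβ t).1.le
  have hi : ∀ i, bregman φ p (x i (t + 1)) ≤ ∑ j, P t i j * bregman φ p (x j t)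
      + α (t + 1) * inner ℝ (g i ((t : ℤ) - τ)) (p - x i (t + 1))
      + L * (2 * ((n + 1) * G / σ)) * (2 * A) * (α t * β t) := fun i => by
    have hw := sum_smul_mem_of_doublyStochastic hX hP t i fun j => h.x_mem j t
    have hy := (h.step_ytil i t).1
    have h1 := (h.step_x i t).bregman_mirror_le hφ hσ hL hX (hα _).1 hp
    have h2 := bregman_le_add_of_lipschitz hφ hσ hL p (ytil i t) (∑ j, P t i j • x j t)
    have h3 := hsep p (fun j => x j t) (fun j => P t i j)
      (fun _ => nonneg_of_mem_doublyStochastic (hP t)) (sum_row_of_mem_doublyStochastic (hP t) i)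
    have h4 := h.norm_average_sub_ytil_le hK hX hP hφ hσ hL hα hβ hG0 hG i t
    have h5 : L * ‖∑ j, P t i j • x j t - ytil i t‖
        * (‖∑ j, P t i j • x j t - ytil i t‖ + ‖p - ∑ j, P t i j • x j t‖)
        ≤ L * (2 * ((n + 1) * G / σ) * (α t * β t)) * (A + A) :=
      mul_le_mul (mul_le_mul_of_nonneg_left h4 hL0) (add_le_add (hA _ hw _ hy) (hA _ hp _ hw))
        (by positivity) (by positivity)
    linarith
  have hcol : ∑ i, ∑ j, P t i j * bregman φ p (x j t) = ∑ j, bregman φ p (x j t) := by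
    rw [Finset.sum_comm]
    refine Finset.sum_congr rfl fun j _ => ?_
    rw [← Finset.sum_mul, sum_col_of_mem_doublyStochastic (hP t) j, one_mul]
  refine (Finset.sum_le_sum fun i _ => hi i).trans_eq ?_
  rw [Finset.sum_add_distrib, Finset.sum_add_distrib, hcol, ← Finset.mul_sum]
  simp only [Finset.sum_const, Finset.card_univ, Fintype.card_fin, nsmul_eq_mul]
  ring

/-- The subgradients taken at the delayed points `ỹ(s)` and applied at time `s + τ` certify the
suboptimality of the state of agent `l`, up to the distances between these points. -/
theorem IsAlgorithmRun.sum_inner_le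
    (h : IsAlgorithmRun X f φ σ G K τ P α β x z y ytil g)
    (hsub : ∀ i, ∀ a ∈ X, ∃ v ∈ subdifferential X (f i) a, ‖v‖ ≤ G)
    (hG : ∀ i, ∀ t : ℕ, ‖g i ((t : ℤ) - τ)‖ ≤ G) {p : Vec n} (hp : p ∈ X) (l : Fin N) (s : ℕ) :
    ∑ i, inner ℝ (g i (((s + τ : ℕ) : ℤ) - τ)) (p - x i (s + τ + 1))
      ≤ ∑ i, f i p - ∑ i, f i (x l (s + 1))
        + G * ∑ i, (‖ytil i s - x i (s + τ + 1)‖ + ‖ytil i s - x l (s + 1)‖) := by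
  rw [Finset.mul_sum, ← Finset.sum_sub_distrib, ← Finset.sum_add_distrib]
  refine Finset.sum_le_sum fun i _ => ?_
  have hg := hG i (s + τ)
  have hsg := h.step_g i (s + τ)
  rw [show ((s + τ : ℕ) : ℤ) - τ = s by push_cast; ring] at hg hsg ⊢
  have h1 := hsg p hp
  obtain ⟨v, hv, hvG⟩ := hsub i (x l (s + 1)) (h.x_mem l _)
  have h2 := hv (ytil i s) (h.step_ytil i s).1
  have h3 : inner ℝ (g i s) (ytil i s - x i (s + τ + 1)) ≤ G * ‖ytil i s - x i (s + τ + 1)‖ :=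
    (real_inner_le_norm _ _).trans (mul_le_mul_of_nonneg_right hg (norm_nonneg _))
  have h4 : -(G * ‖ytil i s - x l (s + 1)‖) ≤ inner ℝ v (ytil i s - x l (s + 1)) :=
    (abs_le.1 ((abs_real_inner_le_norm _ _).trans
      (mul_le_mul_of_nonneg_right hvG (norm_nonneg _)))).1
  have e : p - x i (s + τ + 1) = (p - ytil i s) + (ytil i s - x i (s + τ + 1)) := by abel
  rw [e, inner_add_right]
  linarith

end Run

/-- Jensen's inequality for the running average. -/
theorem ConvexOn.map_runningAverage_le {n : ℕ} {X : Set (Vec n)} {F : Vec n → ℝ}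
    (hF : ConvexOn ℝ X F) {u : ℕ → Vec n} (hu : ∀ t, u t ∈ X) {T : ℕ} (hT : 0 < T) :
    runningAverage u T ∈ X ∧
      F (runningAverage u T) ≤ 1 / (T : ℝ) * ∑ s ∈ Finset.range T, F (u (s + 1)) := by
  have hT0 : (0 : ℝ) < T := by exact_mod_cast hT
  have hw : ∀ s ∈ Finset.range T, (0 : ℝ) ≤ 1 / T := fun _ _ => by positivity
  have hw1 : ∑ _s ∈ Finset.range T, (1 : ℝ) / T = 1 := by
    rw [Finset.sum_const, Finset.card_range, nsmul_eq_mul, mul_one_div_cancel hT0.ne']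
  have e : runningAverage u T = ∑ s ∈ Finset.range T, (1 / (T : ℝ)) • u (s + 1) := by
    rw [runningAverage, ← Finset.smul_sum, Finset.range_eq_Ico, Finset.sum_Ico_add' u 0 T 1]
    rfl
  rw [e]
  refine ⟨hF.1.sum_mem hw hw1 fun s _ => hu _, ?_⟩
  rw [Finset.mul_sum]
  exact hF.map_sum_le hw hw1 fun s _ => hu _

/-! ### Convergence of the running averages -/

theorem theorem2 {N n : ℕ}
    -- the constrained problem
    (X : Set (Vec n)) (hXne : X.Nonempty) (hXconv : Convex ℝ X) (hXcomp : IsCompact X)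
    (f : Fin N → Vec n → ℝ) (hf : ∀ i, ConvexOn ℝ X (f i))
    -- the network: doubly stochastic weights, bounded below on edges, jointly connected
    (P : ℕ → Matrix (Fin N) (Fin N) ℝ) (hP : ∀ t, P t ∈ doublyStochastic ℝ (Fin N))
    (θ : ℝ) (hθ : θ ∈ Set.Ioo (0 : ℝ) 1)
    (hedge : ∀ t i j, Connected P t j i → θ ≤ P t i j) (hdiag : ∀ t i, θ ≤ P t i i)
    (B : ℕ) (hB : 1 ≤ B) (hconn : JointlyStronglyConnected P B)
    -- the distance generating function
    (φ : Vec n → ℝ) (hφ : ContDiff ℝ 1 φ) (σ : ℝ) (hσ : 0 < σ) (hφσ : IsStronglyConvex φ σ)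
    (L : ℝ) (hL : ∀ a b : Vec n, ‖gradient φ a - gradient φ b‖ ≤ L * ‖a - b‖)
    (hsep : SeparatelyConvex N φ)
    (D : ℝ) (hD : ∀ a ∈ X, ∀ b ∈ X, bregman φ a b ≤ D)
    -- the number of quantization levels is `K + 1`, the delay is `τ`
    (K : ℕ) (hK : 1 ≤ K) (τ : ℕ)
    -- stepsizes and quantization parameters
    (α β : ℕ → ℝ) (hα : ∀ t, α t ∈ Set.Ioo (0 : ℝ) 1) (hβ : ∀ t, β t ∈ Set.Ioo (0 : ℝ) 1)
    (hαmono : Antitone α) (hβmono : Antitone β)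
    -- a run of the algorithm
    (G : ℝ) (x z y : Fin N → ℕ → Vec n) (ytil g : Fin N → ℤ → Vec n)
    (hrun : IsAlgorithmRun X f φ σ G K τ P α β x z y ytil g)
    -- bounded subgradients: on all of `X`, and those that the algorithm uses
    (hG : ∀ i, ∀ a ∈ X, ∃ v ∈ subdifferential X (f i) a, ‖v‖ ≤ G)
    (hGrun : ∀ i, ∀ t : ℕ, ‖g i ((t : ℤ) - τ)‖ ≤ G)
    -- the three conditions on the parameters
    (h₁ : Tendsto (fun T : ℕ => 1 / ((T : ℝ) * α (T + τ))) atTop (𝓝 0))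
    (h₂ : Tendsto (fun T : ℕ => 1 / (T : ℝ) * ∑ t ∈ Finset.Icc 1 (T + τ), α t) atTop (𝓝 0))
    (h₃ : Tendsto (fun T : ℕ => 1 / (T : ℝ) * ∑ t ∈ Finset.Icc 1 (T + τ), β t) atTop (𝓝 0))
    -- an optimal point and an agent
    (xstar : Vec n) (hxstar : IsArgmin X (fun v => ∑ i, f i v) xstar) (l : Fin N) :
    Tendsto (fun T : ℕ => ∑ i, f i (runningAverage (x l) T)) atTop
      (𝓝 (∑ i, f i xstar)) := by
  have hG0 : 0 ≤ G := (norm_nonneg _).trans (hGrun l 0)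
  -- A Lipschitz constant is non-negative unless `n = 0`, so it is replaced by its absolute value.
  have hL' : ∀ a b : Vec n, ‖gradient φ a - gradient φ b‖ ≤ |L| * ‖a - b‖ := fun a b =>
    (hL a b).trans (mul_le_mul_of_nonneg_right (le_abs_self L) (norm_nonneg _))
  obtain ⟨A, hA⟩ := Metric.isBounded_iff.1 hXcomp.isBounded
  replace hA : ∀ a ∈ X, ∀ b ∈ X, ‖a - b‖ ≤ A := fun a ha b hb => by
    simpa [dist_eq_norm] using hA ha hb
  have hA0 : 0 ≤ A := (norm_nonneg _).trans (hA _ hxstar.1 _ hxstar.1)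
  have hαpos : ∀ t, 0 < α t := fun t => (hα t).1
  have hα0 := tendsto_zero_of_antitone_of_average (fun t => (hα t).1.le) hαmono τ h₂
  have hβ0 := tendsto_zero_of_antitone_of_average (fun t => (hβ t).1.le) hβmono τ h₃
  set F : Vec n → ℝ := fun v => ∑ i, f i v with hF
  have hFconv : ConvexOn ℝ X F := by
    refine ⟨hXconv, fun a ha b hb r s hr hs hrs => ?_⟩
    simp only [hF, Finset.smul_sum, ← Finset.sum_add_distrib]
    exact Finset.sum_le_sum fun i _ => (hf i).2 ha hb hr hs hrs
  set C : ℝ := N * (|L| * (2 * ((n + 1) * G / σ)) * (2 * A)) with hC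
  have hC0 : 0 ≤ C := by positivity
  set S : ℕ → ℝ := fun t => ∑ i, bregman φ xstar (x i t) with hS
  have hSM : ∀ t, S t ≤ N * D := fun t => by
    refine (Finset.sum_le_sum fun i _ => hD _ hxstar.1 _ (hrun.x_mem i t)).trans_eq ?_
    simp
  set δ : ℕ → ℝ := fun s =>
    G * ∑ i, (‖ytil i s - x i (s + τ + 1)‖ + ‖ytil i s - x l (s + 1)‖) with hδ
  have hmerge := hrun.tendsto_norm_ytil_sub_x hK hXconv hA hP hθ hedge hdiag hB hconn hφσ hσ hL'
    hα hβ hG0 hGrun hα0 hβ0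
  have hδ0 : Tendsto δ atTop (𝓝 0) := by
    have := (tendsto_finsetSum Finset.univ fun i _ =>
      (hmerge i i τ).add (hmerge i l 0)).const_mul G
    simpa using this
  set e : ℕ → ℝ := fun s => δ s + C * β (s + τ) with he
  have he0 : Tendsto e atTop (𝓝 0) := by
    simpa using hδ0.add ((hβ0.comp (tendsto_add_atTop_nat τ)).const_mul C)
  have hstep : ∀ s, F (x l (s + 1)) - F xstar ≤ (S (s + τ) - S (s + τ + 1)) / α (s + τ + 1)
      + C * (1 / α (s + τ + 1) - 1 / α (s + τ)) + e s := fun s => by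
    have h1 := hrun.sum_bregman_succ_le hK hXconv hA hP hφσ hσ (abs_nonneg L) hL' hsep hα hβ hG0
      hGrun hxstar.1 (s + τ)
    have h2 := mul_le_mul_of_nonneg_left (hrun.sum_inner_le hG hGrun hxstar.1 l s)
      (hαpos (s + τ + 1)).le
    have ha := hαpos (s + τ)
    have hb := hαpos (s + τ + 1)
    have hab := hαmono (Nat.le_succ (s + τ))
    have h3 : F (x l (s + 1)) - F xstar ≤ (S (s + τ) - S (s + τ + 1)) / α (s + τ + 1)
        + C * (α (s + τ) * β (s + τ) / α (s + τ + 1)) + δ s := by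
      have h4 : α (s + τ + 1) * (F (x l (s + 1)) - F xstar - δ s)
          ≤ S (s + τ) - S (s + τ + 1) + C * (α (s + τ) * β (s + τ)) := by
        simp only [hF, hS, hδ, hC]
        linarith
      rw [← le_div_iff₀' hb, add_div, mul_div_assoc] at h4
      linarith
    -- The ratio `α (t) / α (t + 1)` need not be bounded, but its excess over `1` is at most the
    -- increment of `1 / α`, which telescopes.
    have h5 : α (s + τ) * β (s + τ) / α (s + τ + 1)
        ≤ β (s + τ) + (1 / α (s + τ + 1) - 1 / α (s + τ)) := by
      have e1 : α (s + τ) * β (s + τ) / α (s + τ + 1) = β (s + τ)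
          + α (s + τ) * β (s + τ) * (1 / α (s + τ + 1) - 1 / α (s + τ)) := by
        field_simp
        ring
      rw [e1]
      have h6 : 0 ≤ 1 / α (s + τ + 1) - 1 / α (s + τ) :=
        sub_nonneg.2 (one_div_le_one_div_of_le hb hab)
      have h7 : α (s + τ) * β (s + τ) ≤ 1 :=
        mul_le_one₀ (hα _).2.le (hβ _).1.le (hβ _).2.le
      linarith [mul_le_mul_of_nonneg_right h7 h6]
    have h8 := mul_le_mul_of_nonneg_left h5 hC0
    simp only [he]
    linarith
  have hsum := sum_le_of_telescoping hαpos hαmono hC0 hSM hstep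
  have hbound : Tendsto (fun T : ℕ => F xstar + ((N * D + C) * (1 / ((T : ℝ) * α (T + τ)))
      + (T : ℝ)⁻¹ * ∑ s ∈ Finset.range T, e s)) atTop (𝓝 (F xstar)) := by
    simpa using ((h₁.const_mul (N * D + C)).add he0.cesaro).const_add (F xstar)
  refine tendsto_of_tendsto_of_tendsto_of_le_of_le' tendsto_const_nhds hbound ?_ ?_
  · filter_upwards [eventually_gt_atTop 0] with T hT
    exact isMinOn_iff.1 hxstar.2 _ (hFconv.map_runningAverage_le (hrun.x_mem l) hT).1
  · filter_upwards [eventually_gt_atTop 0] with T hT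
    have hT0 : (0 : ℝ) < T := by exact_mod_cast hT
    refine (hFconv.map_runningAverage_le (hrun.x_mem l) hT).2.trans ?_
    have hS0 : 0 ≤ S (T + τ) := Finset.sum_nonneg fun i _ => hφσ.bregman_nonneg hσ _ _
    have h1 : ∑ s ∈ Finset.range T, F (x l (s + 1)) ≤ T * F xstar
        + ((N * D + C) / α (T + τ) + ∑ s ∈ Finset.range T, e s) := by
      have h2 := hsum T
      rw [Finset.sum_sub_distrib, Finset.sum_const, Finset.card_range, nsmul_eq_mul] at h2
      have h3 : (N * D + C - S (T + τ)) / α (T + τ) ≤ (N * D + C) / α (T + τ) :=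
        div_le_div_of_nonneg_right (by linarith) (hαpos _).le
      linarith
    refine (mul_le_mul_of_nonneg_left h1 (by positivity)).trans_eq ?_
    have := (hαpos (T + τ)).ne'
    field_simp
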